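/- Theorem. Let $k,\ell\ge 1$ be integers and let $S=\{s_1<\cdots<s_k\}\subset\mathbb{R}$ be the positions of $k$ servers on a line, each of capacity $\ell$. A sequence of $n\le k\ell$ requests $\sigma=r_1\cdots r_n$, $r_i\in\mathbb{R}$, is revealed one request at a time; each request $r_i$ must, on its arrival, be matched irrevocably with a free server $s_j$ (one that has been matched with fewer than $\ell$ requests so far), at cost $|r_i-s_j|$. This is the online facility assignment problem on a line, $\mathrm{OFAL}(k,\ell)$. Let GRDY be the online algorithm that matches each request with the nearest free server, and, if several free servers are nearest, with the one of largest index. For an online algorithm ALG let $\mathrm{ALG}(\sigma|S)$ be its total cost on $\sigma$, and let $\mathrm{OPT}(\sigma|S)$ be the minimum total cost of an (offline) assignment of all requests of $\sigma$ to servers in which each server receives at most $\ell$ requests. ALG is $c$-competitive if $\mathrm{ALG}(\sigma|S)\le c\cdot\mathrm{OPT}(\sigma|S)$ for every such $\sigma$, and its competitive ratio is $\mathcal{R}(\mathrm{ALG})=\inf\{c\ge 1:\ \mathrm{ALG}\text{ is }c\text{-competitive}\}$ (with $\inf\emptyset=+\infty$). Put $U(S)=1$ if $k=1$, and $$U(S)=\frac{s_k-s_1}{\min_{1\le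 j\le k-1}(s_{j+1}-s_j)}\qquad\text{if } k\ge 2.$$ Then $$\mathcal{R}(\mathrm{GRDY})\le 4\,U(S)-1 .$$ -/

import Mathlib

noncomputable section

namespace OnlineFacility

/-- A partial run: the requests that have arrived so far, in order of arrival, each paired with
the server it was irrevocably matched with. The servers are indexed by `Fin k`. -/
abbrev History (X : Type*) (k : ℕ) := List (X × Fin k)

/-- Server `j`, of capacity `ℓ`, is free after `h`: fewer than `ℓ` requests are matched with it. -/
def IsFree {X : Type*} {k : ℕ} (ℓ : ℕ) (h : History X k) (j : Fin k) : Prop :=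
  (h.map Prod.snd).count j < ℓ

/-- A deterministic online algorithm for `k` servers of uniform capacity `ℓ` in the space `X`.
The server of the current request depends on the past and on this request only,
and it has to be free (as long as there is a free server at all). -/
structure OnlineAlgorithm (X : Type*) (k ℓ : ℕ) where
  choose : History X k → X → Fin k
  choose_free : ∀ h r, (∃ j, IsFree ℓ h j) → IsFree ℓ h (choose h r)

/-- Continue the run of an online algorithm from history `h` on the requests in the list. -/
def OnlineAlgorithm.runFrom {X : Type*} {k ℓ : ℕ} (A : OnlineAlgorithm X k ℓ) :
    History X k → List X → History X k
  | h, [] => h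
  | h, r :: σ => A.runFrom (h ++ [(r, A.choose h r)]) σ

/-- The final matching that the algorithm produces on the request sequence `σ`. -/
def OnlineAlgorithm.run {X : Type*} {k ℓ : ℕ} (A : OnlineAlgorithm X k ℓ) (σ : List X) :
    History X k :=
  A.runFrom [] σ

/-- The total cost of a matching, when the server `j` stands at `p j`. -/
def matchingCost {X : Type*} [MetricSpace X] {k : ℕ} (p : Fin k → X) (h : History X k) : ℝ :=
  (h.map fun x => dist x.1 (p x.2)).sum

/-- The cost of the online algorithm `A` on the request sequence `σ`. -/
def OnlineAlgorithm.cost {X : Type*} [MetricSpace X] {k ℓ : ℕ} (p : Fin k → X)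
    (A : OnlineAlgorithm X k ℓ) (σ : List X) : ℝ :=
  matchingCost p (A.run σ)

/-- An offline assignment of `n` requests to `k` servers that respects the capacities `ℓ`. -/
def IsFeasible {n k : ℕ} (ℓ : ℕ) (a : Fin n → Fin k) : Prop :=
  ∀ j : Fin k, (Finset.univ.filter fun i => a i = j).card ≤ ℓ

/-- The cost of an offline assignment of the requests in `σ`. -/
def assignmentCost {X : Type*} [MetricSpace X] {k : ℕ} (p : Fin k → X) (σ : List X)
    (a : Fin σ.length → Fin k) : ℝ :=
  ∑ i, dist (σ.get i) (p (a i))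

/-- The optimal offline cost of `σ`: the minimum of the cost over all feasible assignments. -/
def optCost {X : Type*} [MetricSpace X] {k : ℕ} (p : Fin k → X) (ℓ : ℕ) (σ : List X) : ℝ :=
  sInf {x : ℝ | ∃ a : Fin σ.length → Fin k, IsFeasible ℓ a ∧ assignmentCost p σ a = x}

/-- The infimum in `optCost` is a minimum for all sequences that the servers can serve. -/
theorem optCost_isLeast {X : Type*} [MetricSpace X] {k : ℕ} (p : Fin k → X) (ℓ : ℕ) (σ : List X)
    (hσ : σ.length ≤ k * ℓ) :
    IsLeast {x : ℝ | ∃ a : Fin σ.length → Fin k, IsFeasible ℓ a ∧ assignmentCost p σ a = x}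
      (optCost p ℓ σ) := by
  have hfin : {x : ℝ | ∃ a : Fin σ.length → Fin k,
      IsFeasible ℓ a ∧ assignmentCost p σ a = x}.Finite :=
    (Set.finite_range (assignmentCost p σ)).subset (by rintro x ⟨a, -, rfl⟩; exact ⟨a, rfl⟩)
  have hne : {x : ℝ | ∃ a : Fin σ.length → Fin k,
      IsFeasible ℓ a ∧ assignmentCost p σ a = x}.Nonempty := by
    let f : Fin σ.length → Fin k × Fin ℓ := fun i => finProdFinEquiv.symm (Fin.castLE hσ i)
    have hf : Function.Injective f :=
      finProdFinEquiv.symm.injective.comp (Fin.castLE_injective hσ)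
    refine ⟨_, fun i => (f i).1, fun j => ?_, rfl⟩
    calc (Finset.univ.filter fun i => (f i).1 = j).card
        ≤ (Finset.univ : Finset (Fin ℓ)).card := by
          refine Finset.card_le_card_of_injOn (fun i => (f i).2) (by simp) ?_
          intro x hx y hy hxy
          simp only [Finset.coe_filter, Finset.mem_univ, true_and, Set.mem_ofPred_eq] at hx hy
          exact hf (Prod.ext (hx.trans hy.symm) hxy)
      _ = ℓ := by simp
  exact ⟨hne.csInf_mem hfin, fun x hx => csInf_le hfin.bddBelow hx⟩

/-- `A` is (strictly) `c`-competitive for the servers at `p`: its cost is at most `c` times the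
optimal offline cost, on every request sequence that the servers can serve. -/
def IsCompetitive {X : Type*} [MetricSpace X] {k ℓ : ℕ} (p : Fin k → X)
    (A : OnlineAlgorithm X k ℓ) (c : ℝ) : Prop :=
  ∀ σ : List X, σ.length ≤ k * ℓ → A.cost p σ ≤ c * optCost p ℓ σ

/-- The competitive ratio, the infimum of all `c ≥ 1` such that `A` is `c`-competitive; it is
taken in the extended reals, so that it is `⊤` if there is no such `c`. -/
def competitiveRatio {X : Type*} [MetricSpace X] {k ℓ : ℕ} (p : Fin k → X)
    (A : OnlineAlgorithm X k ℓ) : EReal :=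
  sInf {x : EReal | ∃ c : ℝ, 1 ≤ c ∧ IsCompetitive p A c ∧ (c : EReal) = x}

open Classical in
/-- The free servers that are nearest to the request `r`, after `h`. -/
def nearestFree {X : Type*} [MetricSpace X] {k : ℕ} (p : Fin k → X) (ℓ : ℕ) (h : History X k)
    (r : X) : Finset (Fin k) :=
  Finset.univ.filter fun j =>
    IsFree ℓ h j ∧ ∀ i, IsFree ℓ h i → dist r (p j) ≤ dist r (p i)

theorem nearestFree_nonempty {X : Type*} [MetricSpace X] {k : ℕ} (p : Fin k → X) (ℓ : ℕ)
    (h : History X k) (r : X) (hfree : ∃ j, IsFree ℓ h j) : (nearestFree p ℓ h r).Nonempty := by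
  classical
  obtain ⟨j₀, hj₀⟩ := hfree
  obtain ⟨j, hj, hmin⟩ := Finset.exists_min_image (Finset.univ.filter fun j => IsFree ℓ h j)
    (fun j => dist r (p j)) ⟨j₀, by simpa using hj₀⟩
  refine ⟨j, ?_⟩
  simp only [Finset.mem_filter, Finset.mem_univ, true_and] at hj hmin
  simpa [nearestFree] using ⟨hj, hmin⟩

open Classical in
/-- The greedy algorithm: match each request with the nearest free server, and among several
nearest free servers with the one of largest index. (The value `0` stands for the case that
no server is free, which does not occur on sequences of at most `k * ℓ` requests.) -/
def greedy {X : Type*} [MetricSpace X] {k : ℕ} [NeZero k] (p : Fin k → X) (ℓ : ℕ) :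
    OnlineAlgorithm X k ℓ where
  choose h r := if hne : (nearestFree p ℓ h r).Nonempty then (nearestFree p ℓ h r).max' hne else 0
  choose_free h r hfree := by
    have hne := nearestFree_nonempty p ℓ h r hfree
    have hmem := (nearestFree p ℓ h r).max'_mem hne
    rw [dif_pos hne]
    simp only [nearestFree, Finset.mem_filter] at hmem
    exact hmem.2.1

/-- The smallest gap `d_min` between adjacent servers (used for `k ≥ 2` only). -/
def minGap {k : ℕ} (s : Fin k → ℝ) : ℝ :=
  ⨅ j : Fin (k - 1), (s ⟨j + 1, by omega⟩ - s ⟨j, by omega⟩)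

/-- `U(S) = (s_k - s_1) / d_min` for `k ≥ 2` servers, and `U(S) = 1` for one server. -/
def spreadRatio {k : ℕ} [NeZero k] (s : Fin k → ℝ) : ℝ :=
  if k = 1 then 1
  else (s ⟨k - 1, Nat.sub_lt (Nat.pos_of_neZero k) Nat.one_pos⟩ - s 0) / minGap s

end OnlineFacility

end

namespace OnlineFacility

/-! Write D for the diameter of the server set and d for its minimal gap. Exchange an optimal
matching for the greedy one, request by request. If the optimum serves `r` at `o` and greedy at `g ≠
o`, then `|r - g| ≤ |r - o|`, hence `|r - o| ≥ d/2`. The two choices leave capacities that differ by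
moving one unit between `g` and `o`. If such a move changes the later greedy cost by at most 2D - d,
this loss is at most (4U - 2)|r - o|, and induction gives the factor 4U - 1
(`IsNearestChoice.cost_le`).

The bound 2D - d (`IsNearestChoice.cost_sub_le`) comes from coupling two greedy runs with common
capacities `f` and one extra unit, at `a` in one run and at `b` in the other. The runs keep
differing by one unit until they merge (`IsNearestChoice.step_cases`). A naive sum of the step costs
could grow with the number of requests; `IsNearestChoice.cost_sub_le_of_gap` prevents this by
carrying a gap next to `b` through the induction. -/

/-- A tie-breaking rule: `ch r T` is a nearest point of `T` to `r`, chosen consistently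
when `T` shrinks. -/
structure IsNearestChoice {ι : Type*} (p : ι → ℝ) (ch : ℝ → Finset ι → ι) : Prop where
  mem : ∀ r T, T.Nonempty → ch r T ∈ T
  near : ∀ r T, ∀ j ∈ T, |r - p (ch r T)| ≤ |r - p j|
  consistent : ∀ r T T', T' ⊆ T → ch r T ∈ T' → ch r T' = ch r T

theorem IsNearestChoice.neg {ι : Type*} {p : ι → ℝ} {ch : ℝ → Finset ι → ι}
    (h : IsNearestChoice p ch) : IsNearestChoice (fun j => -p j) (fun r T => ch (-r) T) where
  mem r T := h.mem (-r) T
  near r T j hj := by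
    have := h.near (-r) T j hj
    rw [← abs_neg, ← abs_neg (-r - p j)] at this
    convert this using 2 <;> ring
  consistent r := h.consistent (-r)

theorem two_mul_le_add_of_abs_sub_le {r x y : ℝ} (h : |r - x| ≤ |r - y|) (hxy : x < y) :
    2 * r ≤ x + y := by
  have := sq_le_sq.2 h
  nlinarith

theorem add_le_two_mul_of_abs_sub_le {r x y : ℝ} (h : |r - x| ≤ |r - y|) (hxy : y < x) :
    x + y ≤ 2 * r := by
  have := sq_le_sq.2 h
  nlinarith

/-- A point strictly between two others cannot be weakly farther from `r` than both. This shows that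
no free server lies between the two choices of the coupled runs. -/
theorem le_of_abs_sub_le {r x y z : ℝ} (hx : |r - x| ≤ |r - z|) (hy : |r - y| ≤ |r - z|)
    (hxz : x < z) : y ≤ z := by
  by_contra! hzy
  linarith [two_mul_le_add_of_abs_sub_le hx hxz, add_le_two_mul_of_abs_sub_le hy hzy]

theorem abs_sub_sub_abs_sub_le (r x y : ℝ) : |r - x| - |r - y| ≤ |x - y| := by
  have := abs_sub_abs_le_abs_sub (r - x) (r - y)
  rwa [show r - x - (r - y) = y - x by ring, abs_sub_comm y x] at this

theorem single_le_of_pos {ι : Type*} [DecidableEq ι] {f : ι → ℕ} {c : ι} (hc : 0 < f c) : Pi.single c 1 ≤ f := by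
  intro j
  by_cases h : j = c
  · subst h; simpa [Nat.one_le_iff_ne_zero, Nat.pos_iff_ne_zero] using hc
  · simp [h]

theorem pos_of_sub_single_pos {ι : Type*} [DecidableEq ι] {f : ι → ℕ} {c j : ι} (h : 0 < (f - Pi.single c 1 : ι → ℕ) j) : 0 < f j :=
  lt_of_lt_of_le h (by simp)

theorem add_single_sub_single {ι : Type*} [DecidableEq ι] {f : ι → ℕ} {a c : ι} (hc : 0 < f c) :
    f + Pi.single a 1 - Pi.single c 1 = f - Pi.single c 1 + Pi.single a 1 :=
  (tsub_add_eq_add_tsub (single_le_of_pos hc)).symm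

theorem sub_single_add_single {ι : Type*} [DecidableEq ι] {f : ι → ℕ} {c : ι} (hc : 0 < f c) :
    f - Pi.single c 1 + Pi.single c 1 = f :=
  tsub_add_cancel_of_le (single_le_of_pos hc)

/-! ### Greedy runs from arbitrary capacities, and their coupling -/

section Greedy

variable {ι : Type*} [Fintype ι]

/-- The points with positive remaining capacity. -/
def freeSet (f : ι → ℕ) : Finset ι := Finset.univ.filter fun j => 0 < f j

@[simp] theorem mem_freeSet {f : ι → ℕ} {j : ι} : j ∈ freeSet f ↔ 0 < f j := by
  simp [freeSet]

variable [DecidableEq ι]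

/-- The cost of serving a list of requests by the rule `ch` from remaining capacities `f`. -/
def choiceCost (p : ι → ℝ) (ch : ℝ → Finset ι → ι) : (ι → ℕ) → List ℝ → ℝ
  | _, [] => 0
  | f, r :: σ => |r - p (ch r (freeSet f))| +
      choiceCost p ch (f - Pi.single (ch r (freeSet f)) 1) σ

theorem choiceCost_neg (p : ι → ℝ) (ch : ℝ → Finset ι → ι) (σ : List ℝ) (f : ι → ℕ) :
    choiceCost (fun j => -p j) (fun r T => ch (-r) T) f (σ.map fun r => -r) =
      choiceCost p ch f σ := by
  induction σ generalizing f with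
  | nil => rfl
  | cons r σ ih =>
    simp only [List.map_cons, choiceCost, neg_neg, ih]
    rw [← abs_neg]
    congr 2
    ring

theorem mem_freeSet_add_single {f : ι → ℕ} {a j : ι} :
    j ∈ freeSet (f + Pi.single a 1) ↔ 0 < f j ∨ j = a := by
  by_cases h : j = a
  · subst h; simp
  · simp [h]

variable {p : ι → ℝ} {ch : ℝ → Finset ι → ι}

/-- The possible choices for one request in two runs whose capacities differ by one unit. -/
theorem IsNearestChoice.step_cases (h : IsNearestChoice p ch) (hp : Function.Injective p)
    (f : ι → ℕ) {a b : ι} (hab : p a < p b) (r : ℝ) (σ : List ℝ) :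
    (∃ c, 0 < f c ∧
      choiceCost p ch (f + Pi.single a 1) (r :: σ) - choiceCost p ch (f + Pi.single b 1) (r :: σ) =
        choiceCost p ch (f - Pi.single c 1 + Pi.single a 1) σ -
          choiceCost p ch (f - Pi.single c 1 + Pi.single b 1) σ) ∨
    (choiceCost p ch (f + Pi.single a 1) (r :: σ) - choiceCost p ch (f + Pi.single b 1) (r :: σ) ≤
      p b - p a) ∨
    (∃ c, 0 < f c ∧ p c < p b ∧
      choiceCost p ch (f + Pi.single a 1) (r :: σ) - choiceCost p ch (f + Pi.single b 1) (r :: σ) ≤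
        choiceCost p ch (f - Pi.single c 1 + Pi.single c 1) σ -
          choiceCost p ch (f - Pi.single c 1 + Pi.single b 1) σ) ∨
    (∃ c, 0 < f c ∧ f b = 0 ∧ c ≠ b ∧ p a < p c ∧
      (∀ j, 0 < f j ∨ j = a → |r - p c| ≤ |r - p j|) ∧ (∀ j, 0 < f j → |r - p b| ≤ |r - p j|) ∧
      choiceCost p ch (f + Pi.single a 1) (r :: σ) - choiceCost p ch (f + Pi.single b 1) (r :: σ) =
        (|r - p c| - |r - p b|) + (choiceCost p ch (f - Pi.single c 1 + Pi.single a 1) σ -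
          choiceCost p ch (f - Pi.single c 1 + Pi.single c 1) σ)) := by
  have hne : a ≠ b := by rintro rfl; exact lt_irrefl _ hab
  obtain ⟨x, hx⟩ : ∃ x, ch r (freeSet (f + Pi.single a 1)) = x := ⟨_, rfl⟩
  obtain ⟨y, hy⟩ : ∃ y, ch r (freeSet (f + Pi.single b 1)) = y := ⟨_, rfl⟩
  have hxm := h.mem r (freeSet (f + Pi.single a 1)) ⟨a, mem_freeSet_add_single.2 (.inr rfl)⟩
  have hym := h.mem r (freeSet (f + Pi.single b 1)) ⟨b, mem_freeSet_add_single.2 (.inr rfl)⟩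
  have hxn := h.near r (freeSet (f + Pi.single a 1))
  have hyn := h.near r (freeSet (f + Pi.single b 1))
  have hxc := h.consistent r (freeSet (f + Pi.single a 1)) (freeSet f)
    (fun j hj => mem_freeSet_add_single.2 (.inl (mem_freeSet.1 hj)))
  have hyc := h.consistent r (freeSet (f + Pi.single b 1)) (freeSet f)
    (fun j hj => mem_freeSet_add_single.2 (.inl (mem_freeSet.1 hj)))
  simp only [choiceCost, hx, hy]
  rw [hx] at hxm hxn hxc
  rw [hy] at hym hyn hyc
  simp only [mem_freeSet_add_single] at hxm hym hxn hyn
  rw [mem_freeSet] at hxc hyc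
  by_cases hxy : x = y
  · subst hxy
    have hfx : 0 < f x := by
      rcases hxm with hxm | rfl
      · exact hxm
      · exact hym.resolve_right hne
    refine .inl ⟨x, hfx, ?_⟩
    rw [add_single_sub_single hfx, add_single_sub_single hfx]
    ring
  by_cases hm : x = a ∧ y = b
  · obtain ⟨rfl, rfl⟩ := hm
    refine .inr (.inl ?_)
    rw [add_tsub_cancel_right, add_tsub_cancel_right]
    have := abs_sub_abs_le_abs_sub (r - p x) (r - p y)
    rw [show r - p x - (r - p y) = p y - p x by ring, abs_of_pos (sub_pos.2 hab)] at this
    linarith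
  rcases Nat.eq_zero_or_pos (f y) with hfy | hfy
  · have hyb : y = b := hym.resolve_left (by omega)
    subst hyb
    have hxa : x ≠ a := fun e => hm ⟨e, rfl⟩
    have hfx : 0 < f x := hxm.resolve_right hxa
    refine .inr (.inr (.inr ⟨x, hfx, hfy, hxy, ?_, hxn, fun j hj => hyn j (.inl hj), ?_⟩))
    · by_contra! hlt
      have hlt : p x < p a := lt_of_le_of_ne hlt fun e => hxa (hp e)
      linarith [two_mul_le_add_of_abs_sub_le (hxn a (.inr rfl)) hlt,
        add_le_two_mul_of_abs_sub_le (hyn x (.inl hfx)) (hlt.trans hab)]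
    · rw [add_single_sub_single hfx, add_tsub_cancel_right, sub_single_add_single hfx]
      ring
  -- If both choices were free in `f`, consistency would make each equal to the choice from `freeSet
  -- f`.
  · have hfx : f x = 0 := by
      by_contra hfx
      exact hxy ((hxc (Nat.pos_of_ne_zero hfx)).symm.trans (hyc hfy))
    have hxa : x = a := hxm.resolve_left (by omega)
    subst hxa
    have hyb : y ≠ b := fun e => hm ⟨rfl, e⟩
    refine .inr (.inr (.inl ⟨y, hfy, ?_, ?_⟩))
    · by_contra! hlt
      have hlt : p b < p y := lt_of_le_of_ne hlt fun e => hyb (hp e).symm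
      linarith [add_le_two_mul_of_abs_sub_le (hyn b (.inr rfl)) hlt,
        two_mul_le_add_of_abs_sub_le (hxn y (.inl hfy)) (hab.trans hlt)]
    · rw [add_single_sub_single hfy, add_tsub_cancel_right, sub_single_add_single hfy]
      linarith [hxn y (.inl hfy)]

/-- With nothing free to the right of `b`, the position of the second extra unit can only move left.
Each such move from `b` to `c` costs at most `p b - p c`, so the costs telescope down to `lo`. -/
theorem IsNearestChoice.cost_sub_le_of_forall_le (h : IsNearestChoice p ch)
    (hp : Function.Injective p) {lo : ℝ} (hlo : ∀ j, lo ≤ p j) (σ : List ℝ) (f : ι → ℕ) {a b : ι}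
    (hab : p a < p b) (hf : ∀ j, 0 < f j → p j ≤ p b) :
    choiceCost p ch (f + Pi.single a 1) σ - choiceCost p ch (f + Pi.single b 1) σ ≤
      p b - lo := by
  induction σ generalizing f a b with
  | nil => simpa [choiceCost] using hlo b
  | cons r σ ih =>
    rcases h.step_cases hp f hab r σ with ⟨c, hc, e⟩ | e | ⟨c, hc, hcb, e⟩ |
      ⟨c, hc, hfb, hcb, hac, h1, h2, e⟩
    · rw [e]
      exact ih _ hab fun j hj => hf j (pos_of_sub_single_pos (c := c) hj)
    · linarith [hlo a]
    · exact e.trans (ih _ hcb fun j hj => hf j (pos_of_sub_single_pos (c := c) hj))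
    · have hlt : p c < p b := lt_of_le_of_ne (hf c hc) fun e => hcb (hp e)
      have := ih (f - Pi.single c 1) hac fun j hj => by
        have hj := pos_of_sub_single_pos (c := c) hj
        by_contra! hcj
        have := le_of_abs_sub_le (h1 j (.inl hj)) (h2 j hj) hcj
        have : j = b := hp (le_antisymm (hf j hj) this)
        subst this
        omega
      have h3 := abs_sub_sub_abs_sub_le r (p c) (p b)
      rw [abs_of_neg (sub_neg.2 hlt)] at h3
      linarith

/-- The gap `ρ` on one side of `b` acts as a potential: when the second extra unit jumps from `b` to
`c`, the step costs at most the new gap minus the old one. Once nothing is free to the right of `b`,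
`IsNearestChoice.cost_sub_le_of_forall_le` finishes, with `hρ` absorbing `ρ`. -/
theorem IsNearestChoice.cost_sub_le_of_gap (h : IsNearestChoice p ch)
    (hp : Function.Injective p) {lo hi : ℝ} (hlo : ∀ j, lo ≤ p j) (hhi : ∀ j, p j ≤ hi)
    (σ : List ℝ) (f : ι → ℕ) {a b : ι} (hab : p a < p b) {ρ : ℝ} (hρ : ρ ≤ hi - lo)
    (hgap : (∀ j, 0 < f j ∨ j = a → p j < p b → p j ≤ p b - ρ) ∨
      (∀ j, 0 < f j → p b < p j → p b + ρ ≤ p j)) :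
    choiceCost p ch (f + Pi.single a 1) σ - choiceCost p ch (f + Pi.single b 1) σ ≤
      2 * (hi - lo) - ρ := by
  induction σ generalizing f a b ρ with
  | nil =>
    simp only [choiceCost]
    linarith [hlo a, hhi a]
  | cons r σ ih =>
    rcases h.step_cases hp f hab r σ with ⟨c, hc, e⟩ | e | ⟨c, hc, hcb, e⟩ |
      ⟨c, hc, hfb, hcb, hac, h1, h2, e⟩
    · rw [e]
      exact ih _ hab hρ (hgap.imp (fun H j hj => H j (hj.imp_left (pos_of_sub_single_pos (c := c))))
        (fun H j hj => H j (pos_of_sub_single_pos (c := c) hj)))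
    · linarith [hlo a, hhi b]
    · refine e.trans (ih _ hcb hρ (hgap.imp (fun H j hj => H j (.inl ?_))
        (fun H j hj => H j (pos_of_sub_single_pos (c := c) hj))))
      rcases hj with hj | rfl
      · exact pos_of_sub_single_pos (c := c) hj
      · exact hc
    · by_cases hup : ∃ j, 0 < f j ∧ p b < p j
      swap
      · push Not at hup
        linarith [h.cost_sub_le_of_forall_le hp hlo (r :: σ) f hab hup, hhi b]
      have h3 := abs_sub_sub_abs_sub_le r (p c) (p b)
      rcases lt_or_gt_of_ne (fun e => hcb (hp e) : p c ≠ p b) with hlt | hlt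
      -- Jump to the left: no server free in `f` lies between `c` and `b`, so the next one to the
      -- right of `c` is at or beyond `R`, and the new gap is `p R - p c`.
      · obtain ⟨R, hR, hRmin⟩ := Finset.exists_min_image
          (Finset.univ.filter fun j => 0 < f j ∧ p b < p j) p
          (by obtain ⟨j, hj⟩ := hup; exact ⟨j, by simpa using hj⟩)
        simp only [Finset.mem_filter, Finset.mem_univ, true_and] at hR hRmin
        have := ih (f - Pi.single c 1) hac (ρ := p R - p c) (by linarith [hlo c, hhi R])
          (.inr fun j hj hcj => by
            have hj := pos_of_sub_single_pos (c := c) hj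
            have hbj := le_of_abs_sub_le (h1 j (.inl hj)) (h2 j hj) hcj
            have hne : p b ≠ p j := fun e => by
              have := hp e
              subst this
              omega
            linarith [hRmin j ⟨hj, lt_of_le_of_ne hbj hne⟩])
        rw [abs_of_neg (sub_neg.2 hlt)] at h3
        have h4 := abs_sub_sub_abs_sub_le r (p R) (p b)
        rw [abs_of_pos (sub_pos.2 hR.2)] at h4
        have h5 := h1 R (.inl hR.1)
        -- A gap on the left is paid for by bounding the step by `p R - p b`, since `c` is as near
        -- to `r` as `R`; a gap on the right by the bound `p b - p c`.
        rcases hgap with H | H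
        · linarith [H c (.inl hc) hlt]
        · linarith [H R hR.1 hR.2]
      -- Mirror image, except that `a` counts as an obstacle on the left; it also guarantees that
      -- `L` exists.
      · obtain ⟨L, hL, hLmax⟩ := Finset.exists_max_image
          (Finset.univ.filter fun j => (0 < f j ∨ j = a) ∧ p j < p b) p
          ⟨a, by simpa using hab⟩
        simp only [Finset.mem_filter, Finset.mem_univ, true_and] at hL hLmax
        have := ih (f - Pi.single c 1) hac (ρ := p c - p L) (by linarith [hlo L, hhi c])
          (.inl fun j hj hjc => by
            have hj := hj.imp_left (pos_of_sub_single_pos (c := c))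
            suffices p j < p b by linarith [hLmax j ⟨hj, this⟩]
            rcases hj with hj | rfl
            · by_contra! hbj
              have hbj : p b < p j := lt_of_le_of_ne hbj fun e => by
                have := hp e
                subst this
                omega
              linarith [le_of_abs_sub_le (h2 j hj) (h1 j (.inl hj)) hbj]
            · exact hab)
        rw [abs_of_pos (sub_pos.2 hlt)] at h3
        have h4 := abs_sub_sub_abs_sub_le r (p L) (p b)
        rw [abs_of_neg (sub_neg.2 hL.2)] at h4
        have h5 := h1 L hL.1
        rcases hgap with H | H
        · linarith [H L hL.1 hL.2]
        · linarith [H c hc hlt]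

/-- Moving one unit of capacity changes the cost by at most twice the diameter minus the
minimal distance. -/
theorem IsNearestChoice.cost_sub_le (h : IsNearestChoice p ch) {lo hi d : ℝ}
    (hlo : ∀ j, lo ≤ p j) (hhi : ∀ j, p j ≤ hi) (hd : 0 < d)
    (hsep : ∀ i j, i ≠ j → d ≤ |p i - p j|) (σ : List ℝ) (f : ι → ℕ) {a b : ι} (hab : a ≠ b) :
    choiceCost p ch (f + Pi.single a 1) σ - choiceCost p ch (f + Pi.single b 1) σ ≤
      2 * (hi - lo) - d := by
  have hp : Function.Injective p := fun i j e => by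
    by_contra hij
    have := hsep i j hij
    rw [e, sub_self, abs_zero] at this
    linarith
  have hsep' : ∀ i j, p i < p j → d ≤ p j - p i := fun i j hij => by
    have := hsep j i (by rintro rfl; exact lt_irrefl _ hij)
    rwa [abs_of_pos (sub_pos.2 hij)] at this
  rcases lt_or_gt_of_ne (fun e => hab (hp e) : p a ≠ p b) with hlt | hlt
  · exact h.cost_sub_le_of_gap hp hlo hhi σ f hlt (by linarith [hsep' a b hlt, hlo a, hhi b])
      (.inl fun j _ hj => by linarith [hsep' j b hj])
  -- Reflecting the line reverses the order of `a` and `b`. It also reverses ties, which is harmless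
  -- because the rule need only be consistent.
  · have := h.neg.cost_sub_le_of_gap (fun i j e => hp (neg_injective e)) (lo := -hi) (hi := -lo)
      (fun j => neg_le_neg (hhi j)) (fun j => neg_le_neg (hlo j)) (σ.map fun r => -r) f
      (a := a) (b := b) (neg_lt_neg hlt) (ρ := d) (by linarith [hsep' b a hlt, hlo b, hhi a])
      (.inl fun j _ hj => by linarith [hsep' b j (neg_lt_neg_iff.1 hj)])
    rw [choiceCost_neg, choiceCost_neg] at this
    linarith

/-- The greedy cost is competitive against every matching that respects the capacities. -/
theorem IsNearestChoice.cost_le (h : IsNearestChoice p ch) {lo hi d c : ℝ}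
    (hlo : ∀ j, lo ≤ p j) (hhi : ∀ j, p j ≤ hi) (hd : 0 < d)
    (hsep : ∀ i j, i ≠ j → d ≤ |p i - p j|) (hc : 1 ≤ c)
    (hcd : ∀ i j : ι, i ≠ j → 2 * (hi - lo) - d ≤ (c - 1) * (d / 2))
    (m : List (ℝ × ι)) (f : ι → ℕ) (hm : ∀ j, (m.map Prod.snd).count j ≤ f j) :
    choiceCost p ch f (m.map Prod.fst) ≤ c * (m.map fun x => |x.1 - p x.2|).sum := by
  induction m generalizing f with
  | nil => simp [choiceCost]
  | cons x m ih =>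
    obtain ⟨r, o⟩ := x
    have ho : 0 < f o := lt_of_lt_of_le (by simp) (hm o)
    have hIH := ih (f - Pi.single o 1) fun j => by
      have := hm j
      by_cases hj : j = o
      · subst hj
        simp at this ⊢
        omega
      · simpa [hj, List.count_cons, Ne.symm hj] using this
    simp only [List.map_cons, choiceCost, List.sum_cons]
    have hg := h.mem r (freeSet f) ⟨o, mem_freeSet.2 ho⟩
    have hn := h.near r (freeSet f) o (mem_freeSet.2 ho)
    generalize ch r (freeSet f) = g at hg hn
    rw [mem_freeSet] at hg
    by_cases hgo : g = o
    · subst hgo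
      nlinarith [abs_nonneg (r - p g)]
    · have hg' : 0 < (f - Pi.single o 1 : ι → ℕ) g := by simpa [hgo] using hg
      have ho' : 0 < (f - Pi.single g 1 : ι → ℕ) o := by simpa [Ne.symm hgo] using ho
      -- The common part of the capacities after greedy's choice and after the offline choice; the
      -- extra units sit at `o` and at `g`.
      have key := h.cost_sub_le hlo hhi hd hsep (m.map Prod.fst)
        (f - Pi.single g 1 - Pi.single o 1) (Ne.symm hgo)
      rw [sub_single_add_single ho', tsub_right_comm, sub_single_add_single hg'] at key
      have h1 := hsep g o hgo
      have h2 : |p g - p o| ≤ |r - p g| + |r - p o| := by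
        rw [abs_sub_comm r (p g)]
        exact abs_sub_le _ _ _
      have h3 : (c - 1) * (d / 2) ≤ (c - 1) * |r - p o| :=
        mul_le_mul_of_nonneg_left (by linarith) (by linarith)
      linarith [hcd g o hgo]

end Greedy

/-! ### The greedy algorithm as a consistent nearest choice -/

open Classical in
/-- The nearest point of `T` to `r`, with ties broken towards the largest index. -/
noncomputable def nearestMax {k : ℕ} [NeZero k] (p : Fin k → ℝ) (r : ℝ) (T : Finset (Fin k)) : Fin k :=
  if hne : (T.filter fun j => ∀ i ∈ T, dist r (p j) ≤ dist r (p i)).Nonempty then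
    (T.filter fun j => ∀ i ∈ T, dist r (p j) ≤ dist r (p i)).max' hne else 0

theorem isNearestChoice_nearestMax {k : ℕ} [NeZero k] (p : Fin k → ℝ) :
    IsNearestChoice p (nearestMax p) := by
  classical
  have hne : ∀ (r : ℝ) (T : Finset (Fin k)), T.Nonempty →
      (T.filter fun j => ∀ i ∈ T, dist r (p j) ≤ dist r (p i)).Nonempty := fun r T hT => by
    obtain ⟨j, hj, hmin⟩ := Finset.exists_min_image T (fun j => dist r (p j)) hT
    exact ⟨j, Finset.mem_filter.2 ⟨hj, hmin⟩⟩
  have hmem : ∀ (r : ℝ) (T : Finset (Fin k)), T.Nonempty → nearestMax p r T ∈ T ∧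
      (∀ i ∈ T, dist r (p (nearestMax p r T)) ≤ dist r (p i)) ∧
      ∀ j ∈ T, (∀ i ∈ T, dist r (p j) ≤ dist r (p i)) → j ≤ nearestMax p r T := by
    intro r T hT
    have h1 := Finset.max'_mem _ (hne r T hT)
    rw [Finset.mem_filter] at h1
    rw [nearestMax, dif_pos (hne r T hT)]
    exact ⟨h1.1, h1.2, fun j hj hj' => Finset.le_max' _ _ (Finset.mem_filter.2 ⟨hj, hj'⟩)⟩
  refine ⟨fun r T hT => (hmem r T hT).1, fun r T j hj => ?_, fun r T T' hsub hT' => ?_⟩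
  · simpa only [Real.dist_eq] using (hmem r T ⟨j, hj⟩).2.1 j hj
  · obtain ⟨h1, h2, h3⟩ := hmem r T ⟨_, hsub hT'⟩
    obtain ⟨h1', h2', h3'⟩ := hmem r T' ⟨_, hT'⟩
    refine le_antisymm (h3 _ (hsub h1') fun i hi => ?_) (h3' _ hT' fun i hi => h2 i (hsub hi))
    exact (h2' _ hT').trans (h2 i hi)

theorem greedy_choose_eq {k : ℕ} [NeZero k] (p : Fin k → ℝ) (ℓ : ℕ) (h : History ℝ k) (r : ℝ) :
    (greedy p ℓ).choose h r =
      nearestMax p r (freeSet fun j => ℓ - (h.map Prod.snd).count j) := by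
  classical
  have : nearestFree p ℓ h r = (freeSet fun j => ℓ - (h.map Prod.snd).count j).filter
      fun j => ∀ i ∈ freeSet (fun j => ℓ - (h.map Prod.snd).count j),
        dist r (p j) ≤ dist r (p i) := by
    ext j
    rw [nearestFree, Finset.mem_filter, Finset.mem_filter]
    simp [IsFree]
  simp only [greedy, nearestMax, this]

theorem matchingCost_runFrom_greedy {k : ℕ} [NeZero k] (p : Fin k → ℝ) (ℓ : ℕ) (σ : List ℝ)
    (h : History ℝ k) :
    matchingCost p ((greedy p ℓ).runFrom h σ) = matchingCost p h +
      choiceCost p (nearestMax p) (fun j => ℓ - (h.map Prod.snd).count j) σ := by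
  induction σ generalizing h with
  | nil => simp [OnlineAlgorithm.runFrom, choiceCost]
  | cons r σ ih =>
    rw [OnlineAlgorithm.runFrom, ih, choiceCost, greedy_choose_eq]
    generalize nearestMax p r (freeSet fun j => ℓ - (h.map Prod.snd).count j) = x
    have : (fun j => ℓ - ((h ++ [(r, x)]).map Prod.snd).count j) =
        (fun j => ℓ - (h.map Prod.snd).count j) - Pi.single x 1 := by
      ext j
      by_cases hj : j = x
      · subst hj
        simp [Nat.sub_sub]
      · simp [hj, Ne.symm hj]
    rw [this]
    simp [matchingCost, Real.dist_eq, add_assoc]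

theorem greedy_cost_le {k ℓ : ℕ} [NeZero k] {p : Fin k → ℝ} {lo hi d c : ℝ}
    (hlo : ∀ j, lo ≤ p j) (hhi : ∀ j, p j ≤ hi) (hd : 0 < d)
    (hsep : ∀ i j, i ≠ j → d ≤ |p i - p j|) (hc : 1 ≤ c)
    (hcd : ∀ i j : Fin k, i ≠ j → 2 * (hi - lo) - d ≤ (c - 1) * (d / 2)) :
    IsCompetitive p (greedy p ℓ) c := by
  intro σ hσ
  obtain ⟨a, ha, hcost⟩ := (optCost_isLeast p ℓ σ hσ).1
  rw [← hcost, OnlineAlgorithm.cost, OnlineAlgorithm.run, matchingCost_runFrom_greedy]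
  have key := (isNearestChoice_nearestMax p).cost_le hlo hhi hd hsep hc hcd
    (List.ofFn fun i => (σ.get i, a i)) (fun _ => ℓ) fun j => by
      refine le_trans (le_of_eq ?_) (ha j)
      rw [List.map_ofFn, ← Multiset.coe_count, ← Fin.univ_val_map, Multiset.count_map]
      simp [Finset.card_def, eq_comm]
  rw [List.map_ofFn, List.map_ofFn, List.sum_ofFn] at key
  have e : List.ofFn (Prod.fst ∘ fun i => (σ.get i, a i)) = σ := List.ofFn_get σ
  rw [e] at key
  simpa [matchingCost, assignmentCost, Real.dist_eq] using key

/-! ### The minimal gap and the constant 4U - 1 -/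

theorem minGap_le {k : ℕ} (s : Fin k → ℝ) (j : Fin (k - 1)) :
    minGap s ≤ s ⟨j + 1, by omega⟩ - s ⟨j, by omega⟩ :=
  ciInf_le (Set.finite_range _).bddBelow j

theorem minGap_pos {k : ℕ} (hk : 2 ≤ k) {s : Fin k → ℝ} (hs : StrictMono s) : 0 < minGap s := by
  have : Nonempty (Fin (k - 1)) := ⟨⟨0, by omega⟩⟩
  obtain ⟨j, hj⟩ := exists_eq_ciInf_of_finite
    (f := fun j : Fin (k - 1) => s ⟨j + 1, by omega⟩ - s ⟨j, by omega⟩)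
  rw [minGap, ← hj]
  exact sub_pos.2 (hs (by simp [Fin.lt_def]))

theorem minGap_le_sub {k : ℕ} {s : Fin k → ℝ} (hs : StrictMono s) {i j : Fin k} (hij : i < j) :
    minGap s ≤ s j - s i := by
  have hij' : (i : ℕ) < j := hij
  have h1 := minGap_le s ⟨i, by omega⟩
  have h2 : s ⟨i + 1, by omega⟩ ≤ s j := hs.monotone (Fin.le_def.2 hij')
  simp only [Fin.eta] at h1
  linarith

theorem minGap_le_abs_sub {k : ℕ} {s : Fin k → ℝ} (hs : StrictMono s) {i j : Fin k}
    (hij : i ≠ j) : minGap s ≤ |s i - s j| := by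
  rcases lt_or_gt_of_ne hij with h | h
  · rw [abs_sub_comm]
    exact (minGap_le_sub hs h).trans (le_abs_self _)
  · exact (minGap_le_sub hs h).trans (le_abs_self _)

theorem isCompetitive_greedy {k ℓ : ℕ} [NeZero k] {s : Fin k → ℝ} (hs : StrictMono s) :
    1 ≤ 4 * spreadRatio s - 1 ∧ IsCompetitive s (greedy s ℓ) (4 * spreadRatio s - 1) := by
  have hk0 : 0 < k := Nat.pos_of_neZero k
  have hlo : ∀ j, s 0 ≤ s j := fun j => hs.monotone (Fin.zero_le j)
  have hhi : ∀ j, s j ≤ s ⟨k - 1, Nat.sub_lt hk0 Nat.one_pos⟩ := fun j =>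
    hs.monotone (Fin.le_def.2 (by simp only; omega))
  by_cases hk : k = 1
  · have hsub : ∀ i j : Fin k, i = j := fun i j => Fin.ext (by omega)
    rw [spreadRatio, if_pos hk]
    -- For a single server separation is vacuous, so any positive `d` serves; here `d = 1`.
    exact ⟨by norm_num, greedy_cost_le hlo hhi one_pos (fun i j h => absurd (hsub i j) h)
      (by norm_num) (fun i j h => absurd (hsub i j) h)⟩
  · have hd := minGap_pos (by omega : 2 ≤ k) hs
    have hD := minGap_le_sub hs (i := 0) (j := ⟨k - 1, Nat.sub_lt hk0 Nat.one_pos⟩)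
      (Fin.lt_def.2 (by simp only [Fin.val_zero]; omega))
    have hU : 1 ≤ spreadRatio s := by
      rw [spreadRatio, if_neg hk]
      exact (one_le_div hd).2 hD
    refine ⟨by linarith, greedy_cost_le hlo hhi hd (fun i j h => minGap_le_abs_sub hs h)
      (by linarith) fun i j _ => le_of_eq ?_⟩
    rw [spreadRatio, if_neg hk]
    field_simp
    ring

end OnlineFacility

open OnlineFacility in
theorem mainTheorem3 (k ℓ : ℕ) [NeZero k] (hℓ : 1 ≤ ℓ) (s : Fin k → ℝ) (hs : StrictMono s) :
    competitiveRatio s (greedy s ℓ) ≤ ((4 * spreadRatio s - 1 : ℝ) : EReal) :=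
  sInf_le ⟨_, (isCompetitive_greedy (ℓ := ℓ) hs).1, (isCompetitive_greedy hs).2, rfl⟩
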